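/- Let $R$ be a commutative ring with identity, and let $C$ be a semidualizing $R$-module; that is, $C$ has a resolution by finitely generated projective modules, the homothety map $R\to\operatorname{Hom}_R(C,C)$ is an isomorphism, and $\operatorname{Ext}_R^n(C,C)=0$ for all $n\ge 1$. An $R$-module is called $C$-projective (resp. $C$-flat) if it is isomorphic to $C\otimes_R P$ with $P$ projective (resp. $C\otimes_R F$ with $F$ flat). A $\mathbb Z$-indexed chain complex $X$ of $R$-modules is called projective (resp. $C$-projective, $C$-flat) if $X$ is exact and every cycle module $Z_i(X)$, $i\in\mathbb Z$, is projective (resp. $C$-projective, $C$-flat). A sequence $\mathbf E$ of complexes is called $\operatorname{Hom}(-,\widetilde{\mathcal F_C(R)})$-exact if the sequence of abelian groups $\operatorname{Hom}(\mathbf E,H)$ is exact for every $C$-flat complex $H$, where $\operatorname{Hom}$ is the group of chain maps. A complex $X$ is called $D_C$-projective if there is a $\operatorname{Hom}(-,\widetilde{\mathcal F_C(R)})$-exact exact sequence of complexes $$\cdots\to P_1\xrightarrow{f_1}P_0\xrightarrow{f_0}Q_{-1}\xrightarrow{f_{-1}}Q_{-2}\xrightarrow{f_{-2}}\cdots\qquad(*)$$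 with all $P_i$ projective complexes and all $Q_i$ $C$-projective complexes such that $X\cong\operatorname{Im}f_0$. **Corollary 2.13.** For every $\operatorname{Hom}(-,\widetilde{\mathcal F_C(R)})$-exact exact sequence $(*)$ of complexes of $R$-modules with all $P_i$ projective complexes and all $Q_i$ $C$-projective complexes, the complex $\operatorname{Coker}f_i$ is $D_C$-projective for every $i\in\mathbb Z$. -/

import Mathlib

open CategoryTheory CategoryTheory.Limits
open scoped TensorProduct

universe u

namespace DingC

section Sequences

universe v w

variable {𝒜 : Type w} [Category.{v} 𝒜] [Preadditive 𝒜]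

/-- Given a class `𝓑` of objects, a doubly infinite sequence
`⋯ ⟶ E_{i+1} ⟶ E_i ⟶ E_{i-1} ⟶ ⋯` with vanishing composites is `Hom(-, 𝓑)`-exact if, for
every `B` in `𝓑`, the sequence of abelian groups
`⋯ ⟶ Hom(E_{i-1}, B) ⟶ Hom(E_i, B) ⟶ Hom(E_{i+1}, B) ⟶ ⋯` is exact. -/
def IsHomExact (𝓑 : ObjectProperty 𝒜) (E : ChainComplex 𝒜 ℤ) : Prop :=
  ∀ B : 𝒜, 𝓑 B → ∀ i : ℤ,
    Function.Exact (fun h : E.X (i - 1) ⟶ B => E.d i (i - 1) ≫ h)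
      (fun g : E.X i ⟶ B => E.d (i + 1) i ≫ g)

end Sequences

variable {R : Type u} [CommRing R]

/-- `C` is semidualizing: it has a resolution by finitely generated projective modules, the
homothety map `R → Hom_R(C, C)` is an isomorphism, and `Ext^n_R(C, C) = 0` for all `n ≥ 1`. -/
structure IsSemidualizing (C : ModuleCat.{u} R) : Prop where
  exists_resolution : ∃ P : ProjectiveResolution C, ∀ n : ℕ, Module.Finite R (P.complex.X n)
  homothety_bijective : Function.Bijective (algebraMap R (Module.End R C))
  ext_eq_zero : ∀ n : ℕ, 1 ≤ n → Subsingleton (Abelian.Ext C C n)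

/-- The class `𝒫(R)` of projective modules. -/
def projectiveModules (R : Type u) [CommRing R] : ObjectProperty (ModuleCat.{u} R) :=
  fun M => Module.Projective R M

/-- The class `𝒫_C(R)` of `C`-projective modules: those of the form `C ⊗ P`, `P` projective. -/
def cProjectiveModules (C : ModuleCat.{u} R) : ObjectProperty (ModuleCat.{u} R) :=
  fun M => ∃ P : ModuleCat.{u} R, Module.Projective R P ∧ Nonempty (M ≃ₗ[R] C ⊗[R] P)

/-- The class `ℱ_C(R)` of `C`-flat modules: those of the form `C ⊗ F`, `F` flat. -/
def cFlatModules (C : ModuleCat.{u} R) : ObjectProperty (ModuleCat.{u} R) :=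
  fun M => ∃ F : ModuleCat.{u} R, Module.Flat R F ∧ Nonempty (M ≃ₗ[R] C ⊗[R] F)

/-- For a class `𝒳` of modules, the class of `𝒳`-complexes: the exact complexes all of whose
cycle modules lie in `𝒳`. -/
def tildeClass (𝒳 : ObjectProperty (ModuleCat.{u} R)) :
    ObjectProperty (ChainComplex (ModuleCat.{u} R) ℤ) :=
  fun X => X.Acyclic ∧ ∀ i : ℤ, 𝒳 (X.cycles i)

/-- The class of projective complexes. -/
def projectiveComplexes (R : Type u) [CommRing R] :
    ObjectProperty (ChainComplex (ModuleCat.{u} R) ℤ) :=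
  tildeClass (projectiveModules R)

/-- The class of `C`-projective complexes. -/
def cProjectiveComplexes (C : ModuleCat.{u} R) :
    ObjectProperty (ChainComplex (ModuleCat.{u} R) ℤ) :=
  tildeClass (cProjectiveModules C)

/-- The class of `C`-flat complexes. -/
def cFlatComplexes (C : ModuleCat.{u} R) :
    ObjectProperty (ChainComplex (ModuleCat.{u} R) ℤ) :=
  tildeClass (cFlatModules C)

/-- `E` is an exact sequence of complexes
`⋯ ⟶ P_1 ⟶ P_0 ⟶ Q_{-1} ⟶ Q_{-2} ⟶ ⋯` that is `Hom(-, H)`-exact for all `C`-flat complexes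
`H`, with all `P_i` projective complexes and all `Q_i` `C`-projective complexes.
The map leaving the term of index `i` is `E.d i (i - 1)`. -/
structure IsPQSequence (C : ModuleCat.{u} R)
    (E : ChainComplex (ChainComplex (ModuleCat.{u} R) ℤ) ℤ) : Prop where
  exact : E.Acyclic
  homExact : IsHomExact (cFlatComplexes C) E
  projective : ∀ i : ℤ, 0 ≤ i → projectiveComplexes R (E.X i)
  cProjective : ∀ i : ℤ, i < 0 → cProjectiveComplexes C (E.X i)

/-- A complex `X` is `D_C`-projective if it is isomorphic to the image of the middle map
`P_0 ⟶ Q_{-1}` of some sequence as in `IsPQSequence`. -/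
def IsDCProjective (C : ModuleCat.{u} R) (X : ChainComplex (ModuleCat.{u} R) ℤ) : Prop :=
  ∃ E : ChainComplex (ChainComplex (ModuleCat.{u} R) ℤ) ℤ,
    IsPQSequence C E ∧ Nonempty (X ≅ image (E.d 0 (-1)))

end DingC

/-!
For a module or complex `X`, consider coresolutions `0 ⟶ X ⟶ Q₀ ⟶ Q₁ ⟶ ⋯` by `C`-projectives with
all cosyzygies (and `X` itself) left `Ext`-orthogonal to the `C`-flats. The class of objects having
such a coresolution is closed under extensions (horseshoe lemma), and under kernels of epimorphisms:
if `0 ⟶ K ⟶ P ⟶ Y ⟶ 0` is exact and `P ⟶ Q₀` is the first step of the coresolution of `P`, then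
`Q₀ / K` is an extension of `Q₀ / P` by `Y`. A complex is `D_C`-projective as soon as it lies in
this class, since a projective resolution can be spliced onto its coresolution.

Projective complexes lie in the class. They are direct sums of disks, which reduces the claim to
modules; and for a projective module `P`, applying `Hom(-, C) ⊗ P` to a resolution of `C` by
finitely generated projectives yields a coresolution of `Hom(C, C) ⊗ P ≅ P`. In a sequence as in
the theorem, dimension shifting along the `Hom`-exact sequence shows that all cokernels are left
orthogonal to the `C`-flats; hence those in degrees `≤ 0` are coresolved by the sequence itself,
and those in positive degrees are obtained from them by taking kernels of epimorphisms from
projective complexes.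
-/

namespace DingC

section ExtVanishing

open Abelian

universe w' v w

variable {𝒜 : Type w} [Category.{v} 𝒜] [Abelian 𝒜] [HasExt.{w'} 𝒜]

/-- `Ext^n(X, Y) = 0` for all `n ≥ 1`; the degree is written `n + 1` to avoid a side condition. -/
def ExtVanishes (X Y : 𝒜) : Prop :=
  ∀ (n : ℕ) (e : Ext X Y (n + 1)), e = 0

namespace ExtVanishes

variable {X X' Y Y' : 𝒜} {S : ShortComplex 𝒜}

lemma of_projective (X Y : 𝒜) [Projective X] : ExtVanishes X Y :=
  fun _ e => e.eq_zero_of_projective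

lemma of_iso_left (e : X ≅ X') (h : ExtVanishes X Y) : ExtVanishes X' Y := by
  intro n x
  have hx : (Ext.mk₀ e.inv).comp ((Ext.mk₀ e.hom).comp x (zero_add _)) (zero_add _) = x := by
    rw [Ext.mk₀_comp_mk₀_assoc, e.inv_hom_id, Ext.mk₀_id_comp]
  rw [← hx, h n ((Ext.mk₀ e.hom).comp x (zero_add _)), Ext.comp_zero]

lemma of_iso_right (e : Y ≅ Y') (h : ExtVanishes X Y) : ExtVanishes X Y' := by
  intro n x
  have hx : (x.comp (Ext.mk₀ e.inv) (add_zero _)).comp (Ext.mk₀ e.hom) (add_zero _) = x := by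
    rw [Ext.comp_assoc_of_third_deg_zero, Ext.mk₀_comp_mk₀, e.inv_hom_id, Ext.comp_mk₀_id]
  rw [← hx, h n (x.comp (Ext.mk₀ e.inv) (add_zero _)), Ext.zero_comp]

lemma surjective_precomp (hS : S.ShortExact) (h₃ : ExtVanishes S.X₃ Y) :
    Function.Surjective (fun b : S.X₂ ⟶ Y => S.f ≫ b) := by
  intro a
  obtain ⟨x, hx⟩ := Ext.contravariant_sequence_exact₁ hS Y (Ext.mk₀ a) (add_zero 1) (h₃ 0 _)
  obtain ⟨b, rfl⟩ := (Ext.mk₀_bijective _ _).2 x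
  exact ⟨b, (Ext.mk₀_bijective _ _).1 (by rw [← hx, Ext.mk₀_comp_mk₀])⟩

lemma of_shortExact₁ (hS : S.ShortExact) (h₂ : ExtVanishes S.X₂ Y) (h₃ : ExtVanishes S.X₃ Y) :
    ExtVanishes S.X₁ Y := by
  intro n x
  obtain ⟨x₂, rfl⟩ := Ext.contravariant_sequence_exact₁ hS Y x (add_comm 1 (n + 1)) (h₃ _ _)
  rw [h₂ n x₂, Ext.comp_zero]

lemma of_shortExact₂ (hS : S.ShortExact) (h₁ : ExtVanishes S.X₁ Y) (h₃ : ExtVanishes S.X₃ Y) :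
    ExtVanishes S.X₂ Y := by
  intro n x
  obtain ⟨x₃, rfl⟩ := Ext.contravariant_sequence_exact₂ hS Y x (h₁ _ _)
  rw [h₃ n x₃, Ext.comp_zero]

lemma of_shortExact_right (hS : S.ShortExact) (h₁ : ExtVanishes X S.X₁)
    (h₃ : ExtVanishes X S.X₃) : ExtVanishes X S.X₂ := by
  intro n x
  obtain ⟨x₁, rfl⟩ := Ext.covariant_sequence_exact₂ X hS x (h₃ _ _)
  rw [h₁ n x₁, Ext.zero_comp]

end ExtVanishes

variable {S : ShortComplex 𝒜} {Y : 𝒜}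

lemma ext_one_eq_zero_of_shortExact (hS : S.ShortExact) (h₂ : ∀ e : Ext S.X₂ Y 1, e = 0)
    (hf : Function.Surjective (fun b : S.X₂ ⟶ Y => S.f ≫ b)) (e : Ext S.X₃ Y 1) : e = 0 := by
  obtain ⟨x, rfl⟩ := Ext.contravariant_sequence_exact₃ hS Y e (h₂ _) (add_zero 1)
  obtain ⟨a, rfl⟩ := (Ext.mk₀_bijective _ _).2 x
  obtain ⟨b, rfl⟩ := hf a
  rw [← Ext.mk₀_comp_mk₀]
  exact hS.extClass_comp_assoc _

lemma ext_succ_eq_zero_of_shortExact (hS : S.ShortExact) {n : ℕ}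
    (h₁ : ∀ e : Ext S.X₁ Y n, e = 0) (h₂ : ∀ e : Ext S.X₂ Y (n + 1), e = 0)
    (e : Ext S.X₃ Y (n + 1)) : e = 0 := by
  obtain ⟨x, rfl⟩ := Ext.contravariant_sequence_exact₃ hS Y e (h₂ _) (add_comm 1 n)
  rw [h₁ x, Ext.comp_zero]

lemma ExtVanishes.of_shortExact₃ (hS : S.ShortExact) (h₁ : ExtVanishes S.X₁ Y)
    (h₂ : ExtVanishes S.X₂ Y) (hf : Function.Surjective (fun b : S.X₂ ⟶ Y => S.f ≫ b)) :
    ExtVanishes S.X₃ Y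
  | 0 => ext_one_eq_zero_of_shortExact hS (h₂ 0) hf
  | n + 1 => ext_succ_eq_zero_of_shortExact hS (h₁ n) (h₂ (n + 1))

lemma ExtVanishes.of_forall_exists_shortExact {ι : Type*} {X : ι → 𝒜}
    (h : ∀ i, ∃ (j : ι) (P : 𝒜) (f : X j ⟶ P) (g : P ⟶ X i) (w : f ≫ g = 0),
      (ShortComplex.mk f g w).ShortExact ∧ ExtVanishes P Y ∧
        Function.Surjective (fun b : P ⟶ Y => f ≫ b)) (i : ι) : ExtVanishes (X i) Y := by
  intro n
  induction n generalizing i with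
  | zero =>
    obtain ⟨j, P, f, g, w, hS, hP, hf⟩ := h i
    exact ext_one_eq_zero_of_shortExact hS (hP 0) hf
  | succ n ih =>
    obtain ⟨j, P, f, g, w, hS, hP, -⟩ := h i
    exact ext_succ_eq_zero_of_shortExact hS (ih j) (hP (n + 1))

/-- The left orthogonal class `⊥ℋ` of `ℋ` with respect to `Ext^n`, `n ≥ 1`. -/
def leftExtOrthogonal (ℋ : ObjectProperty 𝒜) : ObjectProperty 𝒜 :=
  fun X => ∀ H, ℋ H → ExtVanishes X H

variable (ℋ : ObjectProperty 𝒜)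

instance : (leftExtOrthogonal ℋ).IsClosedUnderIsomorphisms where
  of_iso e h H hH := (h H hH).of_iso_left e

instance : (leftExtOrthogonal ℋ).IsClosedUnderExtensions where
  prop_X₂_of_shortExact hS h₁ h₃ H hH := .of_shortExact₂ hS (h₁ H hH) (h₃ H hH)

variable {ℋ}

lemma leftExtOrthogonal_X₁ (hS : S.ShortExact) (h₂ : leftExtOrthogonal ℋ S.X₂)
    (h₃ : leftExtOrthogonal ℋ S.X₃) : leftExtOrthogonal ℋ S.X₁ :=
  fun H hH => .of_shortExact₁ hS (h₂ H hH) (h₃ H hH)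

end ExtVanishing

section Syzygies

universe v w

variable {𝒜 : Type w} [Category.{v} 𝒜] [Abelian 𝒜]

/-- `K` is a first syzygy of `X` relative to the class `𝒬`: there is a short exact sequence
`0 ⟶ K ⟶ Q ⟶ X ⟶ 0` with `Q` in `𝒬`. -/
def IsSyzygy (𝒬 : ObjectProperty 𝒜) (K X : 𝒜) : Prop :=
  ∃ (Q : 𝒜) (f : K ⟶ Q) (g : Q ⟶ X) (w : f ≫ g = 0), (ShortComplex.mk f g w).ShortExact ∧ 𝒬 Q

variable {𝒬 : ObjectProperty 𝒜} {K K' X X' : 𝒜}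

lemma IsSyzygy.of_shortExact {S : ShortComplex 𝒜} (hS : S.ShortExact) (h : 𝒬 S.X₂) :
    IsSyzygy 𝒬 S.X₁ S.X₃ :=
  ⟨_, S.f, S.g, S.zero, hS, h⟩

lemma IsSyzygy.of_iso (h : IsSyzygy 𝒬 K X) (eK : K ≅ K') (eX : X ≅ X') : IsSyzygy 𝒬 K' X' := by
  obtain ⟨Q, f, g, w, hS, hQ⟩ := h
  exact ⟨Q, eK.inv ≫ f, g ≫ eX.hom, by simp [reassoc_of% w],
    ShortComplex.shortExact_of_iso (ShortComplex.isoMk eK (Iso.refl Q) eX) hS, hQ⟩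

/-- The last term of a short exact sequence is the cokernel of the first map. -/
noncomputable def cokernelIso {S : ShortComplex 𝒜} (hS : S.ShortExact) : cokernel S.f ≅ S.X₃ :=
  haveI := hS.epi_g
  (cokernelIsCokernel S.f).coconePointUniqueUpToIso hS.exact.gIsCokernel

lemma shortExact_cokernel {S T : ShortComplex 𝒜} (φ : S ⟶ T) (hS : S.ShortExact)
    (hT : T.ShortExact) [Mono φ.τ₃] : (cokernel φ).ShortExact := by
  have := hS.epi_g
  have := hT.epi_g
  have := hT.mono_f
  let I : ShortComplex.SnakeInput 𝒜 :=
    { L₀ := kernel φ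
      L₁ := S
      L₂ := T
      L₃ := cokernel φ
      v₀₁ := kernel.ι φ
      v₁₂ := φ
      v₂₃ := cokernel.π φ
      h₀ := kernelIsKernel φ
      h₃ := cokernelIsCokernel φ
      L₁_exact := hS.exact
      epi_L₁_g := inferInstance
      L₂_exact := hT.exact
      mono_L₂_f := inferInstance }
  have hL₀ : IsZero I.L₀.X₃ :=
    @IsZero.of_mono_eq_zero _ _ _ _ _ I.v₀₁.τ₃ I.mono_v₀₁_τ₃ (zero_of_comp_mono φ.τ₃ I.w₀₂_τ₃)
  exact
    { exact := I.L₃_exact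
      mono_f := I.L₂'_exact.mono_g (hL₀.eq_of_src _ _)
      epi_g := I.epi_L₃_g }

lemma exists_shortExact_cokernels {S T : ShortComplex 𝒜} (φ : S ⟶ T) (hS : S.ShortExact)
    (hT : T.ShortExact) [Mono φ.τ₃] {Y₁ Y₂ Y₃ : 𝒜} (e₁ : cokernel φ.τ₁ ≅ Y₁)
    (e₂ : cokernel φ.τ₂ ≅ Y₂) (e₃ : cokernel φ.τ₃ ≅ Y₃) :
    ∃ (i : Y₁ ⟶ Y₂) (p : Y₂ ⟶ Y₃) (w : i ≫ p = 0), (ShortComplex.mk i p w).ShortExact := by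
  let a₁ : (cokernel φ).X₁ ≅ Y₁ := PreservesCokernel.iso ShortComplex.π₁ φ ≪≫ e₁
  let a₂ : (cokernel φ).X₂ ≅ Y₂ := PreservesCokernel.iso ShortComplex.π₂ φ ≪≫ e₂
  let a₃ : (cokernel φ).X₃ ≅ Y₃ := PreservesCokernel.iso ShortComplex.π₃ φ ≪≫ e₃
  exact ⟨a₁.inv ≫ (cokernel φ).f ≫ a₂.hom, a₂.inv ≫ (cokernel φ).g ≫ a₃.hom, by simp,
    ShortComplex.shortExact_of_iso (ShortComplex.isoMk a₁ a₂ a₃) (shortExact_cokernel φ hS hT)⟩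

lemma IsSyzygy.exists_horseshoe [𝒬.IsClosedUnderBinaryProducts] {S : ShortComplex 𝒜}
    (hS : S.ShortExact) {Y Y' : 𝒜} (hY : IsSyzygy 𝒬 S.X₁ Y) (hY' : IsSyzygy 𝒬 S.X₃ Y')
    (hext : ∀ Q, 𝒬 Q → Function.Surjective (fun b : S.X₂ ⟶ Q => S.f ≫ b)) :
    ∃ (Z : 𝒜) (i : Y ⟶ Z) (p : Z ⟶ Y') (w : i ≫ p = 0),
      (ShortComplex.mk i p w).ShortExact ∧ IsSyzygy 𝒬 S.X₂ Z := by
  obtain ⟨Q, f, g, w, h, hQ⟩ := hY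
  obtain ⟨Q', f', g', w', h', hQ'⟩ := hY'
  obtain ⟨u, hu⟩ := hext Q hQ f
  let T : ShortComplex 𝒜 := ShortComplex.mk (biprod.inl : Q ⟶ Q ⊞ Q') biprod.snd biprod.inl_snd
  have hT : T.ShortExact := (ShortComplex.Splitting.ofHasBinaryBiproduct Q Q').shortExact
  let φ : S ⟶ T :=
    { τ₁ := f, τ₂ := biprod.lift u (S.g ≫ f'), τ₃ := f', comm₁₂ := by ext <;> simp [T, ← hu] }
  have : Mono S.f := hS.mono_f
  have : Mono T.f := hT.mono_f
  have : Mono φ.τ₁ := h.mono_f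
  have : Mono φ.τ₃ := h'.mono_f
  have : Mono φ.τ₂ := ShortComplex.mono_τ₂_of_exact_of_mono φ hS.exact
  have hφ₂ : (ShortComplex.mk φ.τ₂ _ (cokernel.condition φ.τ₂)).ShortExact :=
    { exact := ShortComplex.exact_cokernel φ.τ₂ }
  obtain ⟨i, p, hip, hU⟩ := exists_shortExact_cokernels φ hS hT (cokernelIso h)
    (Iso.refl _) (cokernelIso h')
  exact ⟨_, i, p, hip, hU, .of_shortExact hφ₂
    (𝒬.prop_of_isLimit_binaryFan (BinaryBiproduct.isLimit Q Q') hQ hQ')⟩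

open ZeroObject in
/-- For `S.X₁ ⊆ S.X₂ ⊆ Q`, the quotient `Q / S.X₁` is an extension of `Q / S.X₂` by
`S.X₂ / S.X₁`. -/
lemma IsSyzygy.exists_extension {S : ShortComplex 𝒜} (hS : S.ShortExact) {P' : 𝒜}
    (hP' : IsSyzygy 𝒬 S.X₂ P') :
    ∃ (Z : 𝒜) (i : S.X₃ ⟶ Z) (p : Z ⟶ P') (w : i ≫ p = 0),
      (ShortComplex.mk i p w).ShortExact ∧ IsSyzygy 𝒬 S.X₁ Z := by
  obtain ⟨Q, f, g, w, h, hQ⟩ := hP'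
  have hid : (ShortComplex.mk (𝟙 S.X₁) (0 : S.X₁ ⟶ (0 : 𝒜)) comp_zero).ShortExact :=
    { exact := ShortComplex.exact_of_f_is_kernel _ (KernelFork.IsLimit.ofId _ rfl)
      epi_g := (isZero_zero 𝒜).epi _ }
  let φ : ShortComplex.mk (𝟙 S.X₁) (0 : S.X₁ ⟶ (0 : 𝒜)) comp_zero ⟶ ShortComplex.mk f g w :=
    { τ₁ := S.f, τ₂ := S.f ≫ f, τ₃ := 0 }
  have : Mono S.f := hS.mono_f
  have : Mono f := h.mono_f
  have : Mono φ.τ₃ := (isZero_zero 𝒜).mono _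
  have hfS : (ShortComplex.mk (S.f ≫ f) _ (cokernel.condition _)).ShortExact :=
    { exact := ShortComplex.exact_cokernel (S.f ≫ f) }
  obtain ⟨i, p, hip, hU⟩ := exists_shortExact_cokernels φ hid h (cokernelIso hS) (Iso.refl _)
    cokernelZeroIsoTarget
  exact ⟨_, i, p, hip, hU, .of_shortExact hfS hQ⟩

section Coresolved

open Abelian

universe w'

variable [HasExt.{w'} 𝒜] (𝒬 ℋ : ObjectProperty 𝒜)

/-- The operator on classes of objects whose greatest fixed point is `coresolved 𝒬 ℋ`. -/
def coresolutionStep : ObjectProperty 𝒜 →o ObjectProperty 𝒜 where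
  toFun 𝒢 X := leftExtOrthogonal ℋ X ∧ ∃ Y, IsSyzygy 𝒬 X Y ∧ 𝒢 Y
  monotone' _ _ h _ := fun ⟨hX, Y, hXY, hY⟩ => ⟨hX, Y, hXY, h Y hY⟩

/-- The class of objects `X` in `⊥ℋ` admitting a coresolution `0 ⟶ X ⟶ Q₀ ⟶ Q₁ ⟶ ⋯` by objects
of `𝒬` all of whose cosyzygies are in `⊥ℋ`, encoded coinductively. -/
def coresolved : ObjectProperty 𝒜 :=
  (coresolutionStep 𝒬 ℋ).gfp

variable {𝒬 ℋ}

lemma coresolved_iff {X : 𝒜} :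
    coresolved 𝒬 ℋ X ↔ leftExtOrthogonal ℋ X ∧ ∃ Y, IsSyzygy 𝒬 X Y ∧ coresolved 𝒬 ℋ Y :=
  iff_of_eq (congrFun (coresolutionStep 𝒬 ℋ).map_gfp X).symm

lemma le_coresolved {𝒢 : ObjectProperty 𝒜}
    (h : ∀ X, 𝒢 X → leftExtOrthogonal ℋ X ∧ ∃ Y, IsSyzygy 𝒬 X Y ∧ 𝒢 Y) : 𝒢 ≤ coresolved 𝒬 ℋ :=
  (coresolutionStep 𝒬 ℋ).le_gfp h

lemma coresolved_le_leftExtOrthogonal : coresolved 𝒬 ℋ ≤ leftExtOrthogonal ℋ :=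
  fun _ hX => (coresolved_iff.1 hX).1

instance : (coresolved 𝒬 ℋ).IsClosedUnderIsomorphisms where
  of_iso e hX := by
    obtain ⟨hX, Y, hXY, hY⟩ := coresolved_iff.1 hX
    exact coresolved_iff.2 ⟨(leftExtOrthogonal ℋ).prop_of_iso e hX, Y,
      hXY.of_iso e (Iso.refl Y), hY⟩

lemma isClosedUnderExtensions_coresolved [𝒬.IsClosedUnderBinaryProducts] (h𝒬 : 𝒬 ≤ ℋ) :
    (coresolved 𝒬 ℋ).IsClosedUnderExtensions where
  prop_X₂_of_shortExact {S} hS h₁ h₃ := by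
    let 𝒢 : ObjectProperty 𝒜 := fun Z =>
      ∃ T : ShortComplex 𝒜, T.ShortExact ∧ coresolved 𝒬 ℋ T.X₁ ∧ coresolved 𝒬 ℋ T.X₃ ∧ T.X₂ = Z
    suffices 𝒢 ≤ coresolved 𝒬 ℋ from this _ ⟨S, hS, h₁, h₃, rfl⟩
    refine le_coresolved ?_
    rintro _ ⟨T, hT, h₁, h₃, rfl⟩
    obtain ⟨h₁, Y₁, hY₁, h₁'⟩ := coresolved_iff.1 h₁
    obtain ⟨h₃, Y₃, hY₃, h₃'⟩ := coresolved_iff.1 h₃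
    obtain ⟨Z, i, p, w, hZ, hTZ⟩ := hY₁.exists_horseshoe hT hY₃
      fun Q hQ => (h₃ Q (h𝒬 Q hQ)).surjective_precomp hT
    exact ⟨(leftExtOrthogonal ℋ).prop_X₂_of_shortExact hT h₁ h₃, Z, hTZ, _, hZ, h₁', h₃', rfl⟩

lemma coresolved_X₁ [𝒬.IsClosedUnderBinaryProducts] (h𝒬 : 𝒬 ≤ ℋ) {S : ShortComplex 𝒜}
    (hS : S.ShortExact) (h₂ : coresolved 𝒬 ℋ S.X₂) (h₃ : coresolved 𝒬 ℋ S.X₃) :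
    coresolved 𝒬 ℋ S.X₁ := by
  have := isClosedUnderExtensions_coresolved h𝒬
  obtain ⟨h₂, P', hP', h₂'⟩ := coresolved_iff.1 h₂
  obtain ⟨Z, i, p, w, hZ, hSZ⟩ := hP'.exists_extension hS
  exact coresolved_iff.2 ⟨leftExtOrthogonal_X₁ hS h₂ (coresolved_le_leftExtOrthogonal _ h₃),
    Z, hSZ, (coresolved 𝒬 ℋ).prop_X₂_of_shortExact hZ h₃ h₂'⟩

end Coresolved

end Syzygies

section IntSequences

variable {α : Type*} {p q : α → Prop} {r s : α → α → Prop} {x₀ : α}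

lemma exists_nat_sequence (hr : ∀ x, p x → ∃ y, p y ∧ r x y) (hx₀ : p x₀) :
    ∃ u : ℕ → α, u 0 = x₀ ∧ ∀ n, r (u n) (u (n + 1)) := by
  choose! f hp hrf using hr
  have hu (n : ℕ) : p (f^[n] x₀) := by
    induction n with
    | zero => exact hx₀
    | succ n ih => simpa only [Function.iterate_succ_apply'] using hp _ ih
  exact ⟨fun n => f^[n] x₀, rfl, fun n => by
    simpa only [Function.iterate_succ_apply'] using hrf _ (hu n)⟩

lemma exists_int_sequence (hr : ∀ x, p x → ∃ y, p y ∧ r x y) (hs : ∀ x, q x → ∃ y, q y ∧ s x y)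
    (hp : p x₀) (hq : q x₀) :
    ∃ Z : ℤ → α, Z 0 = x₀ ∧ (∀ j, 0 ≤ j → r (Z j) (Z (j + 1))) ∧
      ∀ j, j < 0 → s (Z (j + 1)) (Z j) := by
  obtain ⟨a, ha₀, ha⟩ := exists_nat_sequence hr hp
  obtain ⟨b, hb₀, hb⟩ := exists_nat_sequence hs hq
  refine ⟨fun | .ofNat n => a n | .negSucc n => b (n + 1), ha₀, ?_, ?_⟩
  · rintro (n | n) hn
    · exact ha n
    · exact absurd (Int.negSucc_lt_zero n) hn.not_gt
  · rintro (n | _ | n) hn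
    · exact absurd (Int.natCast_nonneg n) hn.not_ge
    · change s (a 0) (b (0 + 1))
      rw [ha₀, ← hb₀]
      exact hb 0
    · exact hb (n + 1)

end IntSequences

section Splicing

universe v w

variable {𝒜 : Type w} [Category.{v} 𝒜] [Abelian 𝒜]

lemma exact_epi_comp_iff {A X Y Z : 𝒜} (e : A ⟶ X) [Epi e] {f : X ⟶ Y} {g : Y ⟶ Z}
    (w : f ≫ g = 0) :
    (ShortComplex.mk (e ≫ f) g (by rw [Category.assoc, w, comp_zero])).Exact ↔
      (ShortComplex.mk f g w).Exact := by
  let φ : ShortComplex.mk (e ≫ f) g (by rw [Category.assoc, w, comp_zero]) ⟶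
      ShortComplex.mk f g w := { τ₁ := e, τ₂ := 𝟙 Y, τ₃ := 𝟙 Z }
  have : Epi φ.τ₁ := ‹Epi e›
  have : IsIso φ.τ₂ := inferInstanceAs (IsIso (𝟙 Y))
  have : Mono φ.τ₃ := inferInstanceAs (Mono (𝟙 Z))
  exact ShortComplex.exact_iff_of_epi_of_isIso_of_mono φ

/-- A complex `K` is spliced together from short exact sequences
`0 ⟶ X (j + 1) ⟶ K_j ⟶ X j ⟶ 0`. -/
structure Splicing (K : ChainComplex 𝒜 ℤ) (X : ℤ → 𝒜) where
  i (j : ℤ) : X (j + 1) ⟶ K.X j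
  p (j : ℤ) : K.X j ⟶ X j
  zero (j : ℤ) : i j ≫ p j = 0
  shortExact (j : ℤ) : (ShortComplex.mk (i j) (p j) (zero j)).ShortExact
  d_eq (j : ℤ) : K.d (j + 1) j = p (j + 1) ≫ i j

/-- The complex spliced together from a family of short exact sequences. -/
noncomputable def splice {X E : ℤ → 𝒜} (i : ∀ j, X (j + 1) ⟶ E j) (p : ∀ j, E j ⟶ X j)
    (zero : ∀ j, i j ≫ p j = 0) : ChainComplex 𝒜 ℤ :=
  ChainComplex.of E (fun j => p (j + 1) ≫ i j) (fun j => by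
    rw [Category.assoc, reassoc_of% (zero (j + 1)), zero_comp, comp_zero])

/-- The tautological splicing of `splice i p zero`. -/
noncomputable def spliceSplicing {X E : ℤ → 𝒜} (i : ∀ j, X (j + 1) ⟶ E j) (p : ∀ j, E j ⟶ X j)
    (zero : ∀ j, i j ≫ p j = 0) (hS : ∀ j, (ShortComplex.mk (i j) (p j) (zero j)).ShortExact) :
    Splicing (splice i p zero) X where
  i := i
  p := p
  zero := zero
  shortExact := hS
  d_eq j := ChainComplex.of_d E (fun j => p (j + 1) ≫ i j) j

namespace Splicing

variable {K : ChainComplex 𝒜 ℤ} {X : ℤ → 𝒜} (s : Splicing K X)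

instance mono_i (j : ℤ) : Mono (s.i j) := (s.shortExact j).mono_f

instance epi_p (j : ℤ) : Epi (s.p j) := (s.shortExact j).epi_g

lemma i_d (j : ℤ) : s.i (j + 1) ≫ K.d (j + 1) j = 0 := by
  rw [s.d_eq, reassoc_of% (s.zero (j + 1)), zero_comp]

/-- The cycles in degree `j + 1` are the kernel of `s.p (j + 1)`, because `s.i j` is mono. -/
noncomputable def isKernel (j : ℤ) : IsLimit (KernelFork.ofι (s.i (j + 1)) (s.i_d j)) :=
  isKernelCompMono (s.shortExact (j + 1)).exact.fIsKernel (s.i j) (s.d_eq j)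

include s

lemma acyclic : K.Acyclic := by
  intro j
  obtain ⟨j, rfl⟩ : ∃ k, k + 1 = j := ⟨j - 1, sub_add_cancel j 1⟩
  rw [HomologicalComplex.exactAt_iff' K (j + 1 + 1) (j + 1) j (by simp) (by simp)]
  have h : (ShortComplex.mk (s.p (j + 1 + 1) ≫ s.i (j + 1)) (K.d (j + 1) j)
      (by rw [Category.assoc, s.i_d, comp_zero])).Exact :=
    (exact_epi_comp_iff (s.p (j + 1 + 1)) (s.i_d j)).2
      (ShortComplex.exact_of_f_is_kernel (ShortComplex.mk _ _ _) (s.isKernel j))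
  simp only [← s.d_eq] at h
  exact h

lemma nonempty_cyclesIso (j : ℤ) : Nonempty (K.cycles j ≅ X (j + 1)) := by
  obtain ⟨j, rfl⟩ : ∃ k, k + 1 = j := ⟨j - 1, sub_add_cancel j 1⟩
  exact ⟨(K.cyclesIsKernel (j + 1) j (by simp)).conePointUniqueUpToIso (s.isKernel j)⟩

lemma nonempty_imageIso (i j : ℤ) (h : j + 1 = i) : Nonempty (image (K.d i j) ≅ X i) := by
  subst h
  have : StrongEpi (s.p (j + 1)) := strongEpi_of_epi _
  exact ⟨(image.isoStrongEpiMono (s.p (j + 1)) (s.i j) (s.d_eq j).symm).symm⟩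

lemma surjective_precomp_i_of_isHomExact {𝓑 : ObjectProperty 𝒜} (hK : IsHomExact 𝓑 K) {B : 𝒜}
    (hB : 𝓑 B) (j : ℤ) : Function.Surjective (fun b : K.X j ⟶ B => s.i j ≫ b) := by
  intro a
  have hexact := hK B hB (j + 1)
  rw [add_sub_cancel_right] at hexact
  obtain ⟨b, hb⟩ := (hexact (s.p (j + 1) ≫ a)).1 (by
    simp only [s.d_eq, Category.assoc, reassoc_of% (s.zero (j + 1)), zero_comp, comp_zero])
  refine ⟨b, ?_⟩
  rw [← cancel_epi (s.p (j + 1)), ← hb]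
  simp only [s.d_eq, Category.assoc]

lemma isHomExact_of_surjective_precomp_i {𝓑 : ObjectProperty 𝒜}
    (h : ∀ B, 𝓑 B → ∀ j, Function.Surjective (fun b : K.X j ⟶ B => s.i j ≫ b)) :
    IsHomExact 𝓑 K := by
  intro B hB j g
  obtain ⟨j, rfl⟩ : ∃ k, k + 1 = j := ⟨j - 1, sub_add_cancel j 1⟩
  rw [add_sub_cancel_right]
  constructor
  · intro hg
    have hig : s.i (j + 1) ≫ g = 0 := by
      rw [← cancel_epi (s.p (j + 1 + 1)), ← Category.assoc, ← s.d_eq, comp_zero]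
      exact hg
    obtain ⟨b, hb⟩ := h B hB j ((s.shortExact (j + 1)).exact.desc g hig)
    refine ⟨b, ?_⟩
    have hdb : K.d (j + 1) j ≫ b = s.p (j + 1) ≫ (s.shortExact (j + 1)).exact.desc g hig := by
      rw [s.d_eq, Category.assoc]
      exact congrArg (s.p (j + 1) ≫ ·) hb
    exact hdb.trans ((s.shortExact (j + 1)).exact.g_desc g hig)
  · rintro ⟨b, rfl⟩
    simp

end Splicing

section Opcycles

variable {ι : Type*} {c : ComplexShape ι} (K : HomologicalComplex 𝒜 c) (i j : ι)

lemma fromOpcycles_pOpcycles : K.fromOpcycles i j ≫ K.pOpcycles j = 0 := by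
  rw [← cancel_epi (K.pOpcycles i), K.p_fromOpcycles_assoc, K.d_pOpcycles, comp_zero]

lemma shortExact_opcycles {i j : ι} (hij : c.Rel i j) (hK : K.ExactAt i) :
    (ShortComplex.mk _ _ (fromOpcycles_pOpcycles K i j)).ShortExact where
  exact := by
    have h : (ShortComplex.mk (K.d i j) (K.pOpcycles j) (K.d_pOpcycles i j)).Exact :=
      ShortComplex.exact_of_g_is_cokernel _ (K.opcyclesIsCokernel i j (c.prev_eq' hij))
    simp only [← K.p_fromOpcycles i j] at h
    exact (exact_epi_comp_iff (K.pOpcycles i) (fromOpcycles_pOpcycles K i j)).1 h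
  mono_f := Preadditive.mono_of_isZero_kernel' _
    (K.homologyIsKernel i j (c.next_eq' hij)) hK.isZero_homology
  epi_g := inferInstanceAs (Epi (K.pOpcycles j))

end Opcycles

/-- An acyclic complex is spliced together from its opcycles. -/
noncomputable def Splicing.ofAcyclic {K : ChainComplex 𝒜 ℤ} (hK : K.Acyclic) :
    Splicing K (fun j => K.opcycles j) where
  i j := K.fromOpcycles (j + 1) j
  p j := K.pOpcycles j
  zero j := fromOpcycles_pOpcycles K (j + 1) j
  shortExact j := shortExact_opcycles K rfl (hK (j + 1))
  d_eq j := (K.p_fromOpcycles (j + 1) j).symm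

end Splicing

section Coresolutions

open Abelian

universe w' v w

variable {𝒜 : Type w} [Category.{v} 𝒜] [Abelian 𝒜] [HasExt.{w'} 𝒜]
  {𝒢 𝒬 ℋ : ObjectProperty 𝒜}

lemma Splicing.leftExtOrthogonal {K : ChainComplex 𝒜 ℤ} {X : ℤ → 𝒜} (s : Splicing K X)
    (hom_exact : IsHomExact ℋ K) (hK : ∀ j, leftExtOrthogonal ℋ (K.X j)) (j : ℤ) :
    leftExtOrthogonal ℋ (X j) :=
  fun H hH => .of_forall_exists_shortExact (fun j => ⟨j + 1, K.X j, s.i j, s.p j, s.zero j,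
    s.shortExact j, hK j H hH, s.surjective_precomp_i_of_isHomExact hom_exact hH j⟩) j

lemma Splicing.coresolved [𝒬.IsClosedUnderBinaryProducts] {K : ChainComplex 𝒜 ℤ} {X : ℤ → 𝒜}
    (s : Splicing K X) (hom_exact : IsHomExact ℋ K) (h𝒬 : 𝒬 ≤ ℋ)
    (h𝒬' : 𝒬 ≤ DingC.leftExtOrthogonal ℋ) (hK : ∀ j, 0 ≤ j → coresolved 𝒬 ℋ (K.X j))
    (hK' : ∀ j, j < 0 → 𝒬 (K.X j)) (j : ℤ) : coresolved 𝒬 ℋ (X j) := by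
  have hX := s.leftExtOrthogonal hom_exact fun j => (lt_or_ge j 0).elim
    (fun hj => h𝒬' _ (hK' j hj)) fun hj => coresolved_le_leftExtOrthogonal _ (hK j hj)
  have hX_nonpos (j : ℤ) (hj : j ≤ 0) : DingC.coresolved 𝒬 ℋ (X j) := by
    refine le_coresolved (𝒢 := fun Y => ∃ j ≤ 0, X j = Y) ?_ _ ⟨j, hj, rfl⟩
    rintro _ ⟨j, hj, rfl⟩
    obtain ⟨j, rfl⟩ : ∃ k, k + 1 = j := ⟨j - 1, sub_add_cancel j 1⟩
    exact ⟨hX (j + 1), X j, .of_shortExact (s.shortExact j) (hK' j (by lia)), j, by lia, rfl⟩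
  rcases le_total j 0 with hj | hj
  · exact hX_nonpos j hj
  · induction j, hj using Int.leInduction with
    | base => exact hX_nonpos 0 le_rfl
    | succ j hj ih => exact coresolved_X₁ h𝒬 (s.shortExact j) (hK j hj) ih

lemma exists_splicing_of_coresolved (hsyz : ∀ X, ∃ K, IsSyzygy 𝒢 K X)
    (h𝒢 : 𝒢 ≤ leftExtOrthogonal ℋ) {X : 𝒜} (hX : coresolved 𝒬 ℋ X) :
    ∃ (K : ChainComplex 𝒜 ℤ) (Z : ℤ → 𝒜) (_ : Splicing K Z), IsHomExact ℋ K ∧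
      (∀ j, 0 ≤ j → 𝒢 (K.X j)) ∧ (∀ j, j < 0 → 𝒬 (K.X j)) ∧ Z 0 = X := by
  have left_step (Y : 𝒜) (hY : leftExtOrthogonal ℋ Y) : ∃ Y', leftExtOrthogonal ℋ Y' ∧
      IsSyzygy 𝒢 Y' Y ∧ leftExtOrthogonal ℋ Y := by
    obtain ⟨K, P, f, g, w, hS, hP⟩ := hsyz Y
    exact ⟨K, leftExtOrthogonal_X₁ hS (h𝒢 P hP) hY, ⟨P, f, g, w, hS, hP⟩, hY⟩
  have right_step (Y : 𝒜) (hY : coresolved 𝒬 ℋ Y) : ∃ Y', coresolved 𝒬 ℋ Y' ∧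
      IsSyzygy 𝒬 Y Y' ∧ leftExtOrthogonal ℋ Y' := by
    obtain ⟨-, Y', hYY', hY'⟩ := coresolved_iff.1 hY
    exact ⟨Y', hY', hYY', coresolved_le_leftExtOrthogonal _ hY'⟩
  obtain ⟨Z, hZ₀, hZ, hZ'⟩ := exists_int_sequence left_step right_step
    (coresolved_le_leftExtOrthogonal _ hX) hX
  have hZ_orth (j : ℤ) : leftExtOrthogonal ℋ (Z j) :=
    (lt_or_ge j 0).elim (fun hj => (hZ' j hj).2) fun hj => (hZ j hj).2
  have hE (j : ℤ) : ∃ (E : 𝒜) (f : Z (j + 1) ⟶ E) (g : E ⟶ Z j) (w : f ≫ g = 0),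
      (ShortComplex.mk f g w).ShortExact ∧ (0 ≤ j → 𝒢 E) ∧ (j < 0 → 𝒬 E) := by
    rcases lt_or_ge j 0 with hj | hj
    · obtain ⟨E, f, g, w, hS, hE⟩ := (hZ' j hj).1
      exact ⟨E, f, g, w, hS, fun h => absurd hj h.not_gt, fun _ => hE⟩
    · obtain ⟨E, f, g, w, hS, hE⟩ := (hZ j hj).1
      exact ⟨E, f, g, w, hS, fun _ => hE, fun h => absurd hj h.not_ge⟩
  choose E i p w hS h𝒢E h𝒬E using hE
  exact ⟨splice i p w, Z, spliceSplicing i p w hS,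
    (spliceSplicing i p w hS).isHomExact_of_surjective_precomp_i
      fun H hH j => (hZ_orth j H hH).surjective_precomp (hS j), h𝒢E, h𝒬E, hZ₀⟩

end Coresolutions

section Disks

open Abelian

universe w' w'' v w

variable {𝒜 : Type w} [Category.{v} 𝒜] [Abelian 𝒜]

lemma shortExact_biprodMap {S T : ShortComplex 𝒜} (hS : S.ShortExact) (hT : T.ShortExact) :
    (ShortComplex.mk (biprod.map S.f T.f) (biprod.map S.g T.g)
      (by ext <;> simp)).ShortExact := by
  have := hS.mono_f
  have := hT.mono_f
  have := hS.epi_g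
  have := hT.epi_g
  exact
    { exact := ShortComplex.exact_of_f_is_kernel _ <| KernelFork.IsLimit.ofι' _ _ fun k hk =>
        ⟨biprod.lift (hS.exact.lift (k ≫ biprod.fst) (by simpa using hk =≫ biprod.fst))
          (hT.exact.lift (k ≫ biprod.snd) (by simpa using hk =≫ biprod.snd)), by ext <;> simp⟩
      mono_f := inferInstance
      epi_g := inferInstance }

variable {M N L : ℤ → 𝒜} {K Y : ChainComplex 𝒜 ℤ}

variable (M) in
/-- The direct sum over `j` of the disk complexes `M j = M j` in degrees `j` and `j - 1`: the
contractible complex with `M (j + 1) ⊞ M j` in degree `j`. -/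
noncomputable def disk : ChainComplex 𝒜 ℤ :=
  splice (X := M) (E := fun j => M (j + 1) ⊞ M j) (fun _ => biprod.inl) (fun _ => biprod.snd)
    (fun _ => biprod.inl_snd)

variable (M) in
/-- The splicing of `disk M` from split short exact sequences. -/
noncomputable def diskSplicing : Splicing (disk M) M :=
  spliceSplicing _ _ _ fun j =>
    (ShortComplex.Splitting.ofHasBinaryBiproduct (M (j + 1)) (M j)).shortExact

variable (M) in
/-- The object of degree `j` of `disk M`. -/
noncomputable def diskXIso (j : ℤ) : (disk M).X j ≅ M (j + 1) ⊞ M j :=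
  Iso.refl _

variable (M) in
lemma disk_d (j : ℤ) : (disk M).d (j + 1) j =
    (diskXIso M (j + 1)).hom ≫ biprod.snd ≫ biprod.inl ≫ (diskXIso M j).inv :=
  ((diskSplicing M).d_eq j).trans (by
    change biprod.snd ≫ biprod.inl = 𝟙 _ ≫ biprod.snd ≫ biprod.inl ≫ 𝟙 (M (j + 1) ⊞ M j)
    rw [Category.comp_id, Category.id_comp])

variable (M) in
/-- The inclusion of the generators of degree `j` of `disk M`. -/
noncomputable def diskι (j : ℤ) : M j ⟶ (disk M).X j :=
  biprod.inr ≫ (diskXIso M j).inv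

/-- The chain map out of `disk M` with prescribed values on generators. -/
noncomputable def diskDesc (φ : ∀ j, M j ⟶ Y.X j) : disk M ⟶ Y where
  f j := (diskXIso M j).hom ≫ biprod.desc (φ (j + 1) ≫ Y.d (j + 1) j) (φ j)
  comm' i j hij := by
    obtain rfl : j + 1 = i := hij
    rw [disk_d, ← cancel_epi (diskXIso M (j + 1)).inv]
    ext <;> simp

lemma diskι_diskDesc (φ : ∀ j, M j ⟶ Y.X j) (j : ℤ) : diskι M j ≫ (diskDesc φ).f j = φ j := by
  simp [diskι, diskDesc]

lemma diskι_d (j : ℤ) :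
    diskι M (j + 1) ≫ (disk M).d (j + 1) j = biprod.inl ≫ (diskXIso M j).inv := by
  simp [diskι, disk_d]

lemma disk_hom_ext {f g : disk M ⟶ Y} (h : ∀ j, diskι M j ≫ f.f j = diskι M j ≫ g.f j) :
    f = g := by
  have inl_comp (k : disk M ⟶ Y) (j : ℤ) : biprod.inl ≫ (diskXIso M j).inv ≫ k.f j =
      (diskι M (j + 1) ≫ k.f (j + 1)) ≫ Y.d (j + 1) j := by
    rw [Category.assoc, k.comm, ← Category.assoc, ← Category.assoc, diskι_d]
  ext j : 1
  rw [← cancel_epi (diskXIso M j).inv]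
  refine biprod.hom_ext' _ _ (by rw [inl_comp, inl_comp, h]) ?_
  simpa only [diskι, Category.assoc] using h j

/-- The functoriality of `disk`. -/
noncomputable def diskMap (f : ∀ j, M j ⟶ N j) : disk M ⟶ disk N where
  f j := (diskXIso M j).hom ≫ biprod.map (f (j + 1)) (f j) ≫ (diskXIso N j).inv
  comm' i j hij := by
    obtain rfl : j + 1 = i := hij
    simp [disk_d]

lemma diskMap_comp_diskXIso_hom (f : ∀ j, M j ⟶ N j) (j : ℤ) :
    (diskMap f).f j ≫ (diskXIso N j).hom =
      (diskXIso M j).hom ≫ biprod.map (f (j + 1)) (f j) := by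
  simp [diskMap]

lemma diskι_diskMap (f : ∀ j, M j ⟶ N j) (j : ℤ) :
    diskι M j ≫ (diskMap f).f j = f j ≫ diskι N j := by
  simp [diskι, diskMap]

lemma diskMap_comp_diskMap_eq_zero (f : ∀ j, M j ⟶ N j) (g : ∀ j, N j ⟶ L j)
    (w : ∀ j, f j ≫ g j = 0) : diskMap f ≫ diskMap g = 0 := by
  refine disk_hom_ext fun j => ?_
  rw [HomologicalComplex.comp_f, ← Category.assoc, diskι_diskMap, Category.assoc, diskι_diskMap,
    reassoc_of% (w j), zero_comp, HomologicalComplex.zero_f, comp_zero]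

lemma shortExact_diskMap (f : ∀ j, M j ⟶ N j) (g : ∀ j, N j ⟶ L j) (w : ∀ j, f j ≫ g j = 0)
    (hS : ∀ j, (ShortComplex.mk (f j) (g j) (w j)).ShortExact) :
    (ShortComplex.mk (diskMap f) (diskMap g) (diskMap_comp_diskMap_eq_zero f g w)).ShortExact :=
  HomologicalComplex.shortExact_of_degreewise_shortExact _ fun j =>
    ShortComplex.shortExact_of_iso
      (ShortComplex.isoMk (diskXIso M j) (diskXIso N j) (diskXIso L j)
        (diskMap_comp_diskXIso_hom f j).symm (diskMap_comp_diskXIso_hom g j).symm).symm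
      (shortExact_biprodMap (hS (j + 1)) (hS j))

instance epi_diskDesc (φ : ∀ j, M j ⟶ Y.X j) [∀ j, Epi (φ j)] : Epi (diskDesc φ) :=
  HomologicalComplex.epi_of_epi_f _ fun j => epi_of_epi_fac (diskι_diskDesc φ j)

instance projective_disk [∀ j, Projective (M j)] : Projective (disk M) where
  factors f e _ := ⟨diskDesc (fun j => Projective.factorThru (diskι M j ≫ f.f j) (e.f j)),
    disk_hom_ext fun j => by simp [reassoc_of% diskι_diskDesc]⟩

instance [EnoughProjectives 𝒜] : EnoughProjectives (ChainComplex 𝒜 ℤ) where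
  presentation Y := ⟨
    { p := disk (fun j => Projective.over (Y.X j))
      f := diskDesc (fun j => Projective.π (Y.X j)) }⟩

/-- A degreewise split acyclic complex is a sum of disks. -/
noncomputable def Splicing.isoDisk (s : Splicing K M)
    (h : ∀ j, (ShortComplex.mk (s.i j) (s.p j) (s.zero j)).Splitting) : K ≅ disk M :=
  HomologicalComplex.Hom.isoOfComponents
    (fun j => (h j).isoBinaryBiproduct ≪≫ (diskXIso M j).symm) fun i j hij => by
      obtain rfl : j + 1 = i := hij
      have i_lift : s.i j ≫ biprod.lift (h j).r (s.p j) = biprod.inl :=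
        biprod.hom_ext _ _ (by simpa using (h j).f_r) (by simpa using s.zero j)
      simp [disk_d, s.d_eq, reassoc_of% i_lift]

lemma shortExact_kernel_ι {X Z : 𝒜} (f : X ⟶ Z) [Epi f] :
    (ShortComplex.mk (kernel.ι f) f (kernel.condition f)).ShortExact where
  exact := ShortComplex.exact_of_f_is_kernel _ (kernelIsKernel f)

variable [HasExt.{w'} 𝒜]

lemma Splicing.nonempty_iso_disk (s : Splicing K M) (h : ∀ j, ExtVanishes (M j) (M (j + 1))) :
    Nonempty (K ≅ disk M) := by
  choose r hr using fun j => (h j).surjective_precomp (s.shortExact j) (𝟙 (M (j + 1)))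
  exact ⟨s.isoDisk fun j => .ofExactOfRetraction _ (s.shortExact j).exact (r j) (hr j)
    (s.epi_p j)⟩

lemma extVanishes_disk [EnoughProjectives 𝒜] [HasExt.{w''} (ChainComplex 𝒜 ℤ)]
    (h : ∀ j, ExtVanishes (M j) (Y.X j)) : ExtVanishes (disk M) Y := by
  let 𝒢 := {N : ℤ → 𝒜 // ∀ j, ExtVanishes (N j) (Y.X j)}
  refine ExtVanishes.of_forall_exists_shortExact (ι := 𝒢) (X := fun N => disk N.1) ?_ ⟨M, h⟩
  rintro ⟨N, hN⟩
  have hS (j : ℤ) := shortExact_kernel_ι (Projective.π (N j))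
  refine ⟨⟨_, fun j => .of_shortExact₁ (hS j) (.of_projective _ _) (hN j)⟩, _, _, _, _,
    shortExact_diskMap _ _ _ hS, .of_projective _ _, fun a => ?_⟩
  choose b hb using fun j => (hN j).surjective_precomp (hS j)
    (diskι (fun j => kernel (Projective.π (N j))) j ≫ a.f j)
  exact ⟨diskDesc b, disk_hom_ext fun j => by
    rw [HomologicalComplex.comp_f, ← Category.assoc, diskι_diskMap, Category.assoc, diskι_diskDesc]
    exact hb j⟩

end Disks

section TildeClasses

open Abelian

lemma isClosedUnderBinaryProducts_of_biprod {𝒜 : Type*} [Category* 𝒜] [Abelian 𝒜]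
    {𝒬 : ObjectProperty 𝒜} [𝒬.IsClosedUnderIsomorphisms]
    (h : ∀ X Y, 𝒬 X → 𝒬 Y → 𝒬 (X ⊞ Y)) : 𝒬.IsClosedUnderBinaryProducts where
  limitsOfShape_le := by
    rintro X ⟨p⟩
    refine 𝒬.prop_of_iso ?_ (h _ _ (p.prop_diag_obj (.mk .left)) (p.prop_diag_obj (.mk .right)))
    exact (BinaryBiproduct.isLimit _ _).conePointUniqueUpToIso
      ((IsLimit.postcomposeHomEquiv (diagramIsoPair p.diag) _).2 p.isLimit)

instance {𝒜 ι : Type*} [Category* 𝒜] [Abelian 𝒜] (c : ComplexShape ι) (i : ι) :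
    (HomologicalComplex.cyclesFunctor 𝒜 c i).Additive where
  map_add {X Y f g} := by
    change HomologicalComplex.cyclesMap (f + g) i =
      HomologicalComplex.cyclesMap f i + HomologicalComplex.cyclesMap g i
    simp [← cancel_mono (Y.iCycles i)]

variable {R : Type u} [CommRing R] {𝒳 𝒴 𝒵 : ObjectProperty (ModuleCat.{u} R)}

instance [𝒳.IsClosedUnderIsomorphisms] : (tildeClass 𝒳).IsClosedUnderIsomorphisms where
  of_iso e h := ⟨fun i => (h.1 i).of_iso e, fun i =>
    𝒳.prop_of_iso ((HomologicalComplex.cyclesFunctor _ _ i).mapIso e) (h.2 i)⟩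

instance [𝒳.IsClosedUnderIsomorphisms] [𝒳.IsClosedUnderBinaryProducts] :
    (tildeClass 𝒳).IsClosedUnderBinaryProducts :=
  isClosedUnderBinaryProducts_of_biprod fun X Y hX hY => by
    have (F : ChainComplex (ModuleCat.{u} R) ℤ ⥤ ModuleCat.{u} R) [F.Additive] :
        PreservesBinaryBiproducts F := preservesBinaryBiproducts_of_preservesBiproducts F
    refine ⟨fun i => ?_, fun i => 𝒳.prop_of_iso
      ((HomologicalComplex.cyclesFunctor _ _ i).mapBiprod X Y).symm
      (𝒳.prop_of_isLimit_binaryFan (BinaryBiproduct.isLimit _ _) (hX.2 i) (hY.2 i))⟩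
    rw [HomologicalComplex.exactAt_iff_isZero_homology]
    refine IsZero.of_iso ?_ ((HomologicalComplex.homologyFunctor _ _ i).mapBiprod X Y)
    exact (biprod_isZero_iff _ _).2 ⟨(hX.1 i).isZero_homology, (hY.1 i).isZero_homology⟩

lemma tildeClass_mono (h : 𝒳 ≤ 𝒴) : tildeClass 𝒳 ≤ tildeClass 𝒴 :=
  fun _ hX => ⟨hX.1, fun i => h _ (hX.2 i)⟩

variable {K : ChainComplex (ModuleCat.{u} R) ℤ} {M : ℤ → ModuleCat.{u} R}

lemma Splicing.tildeClass [𝒳.IsClosedUnderIsomorphisms] (s : Splicing K M)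
    (h : ∀ j, 𝒳 (M j)) : tildeClass 𝒳 K :=
  ⟨s.acyclic, fun j => 𝒳.prop_of_iso (s.nonempty_cyclesIso j).some.symm (h (j + 1))⟩

lemma opcycles_of_tildeClass [𝒳.IsClosedUnderIsomorphisms] (hK : tildeClass 𝒳 K) (j : ℤ) :
    𝒳 (K.opcycles j) := by
  obtain ⟨j, rfl⟩ : ∃ k, k + 1 = j := ⟨j - 1, sub_add_cancel j 1⟩
  exact 𝒳.prop_of_iso ((Splicing.ofAcyclic hK.1).nonempty_cyclesIso j).some (hK.2 j)

lemma exists_iso_disk [𝒳.IsClosedUnderIsomorphisms] (h𝒳 : 𝒳 ≤ leftExtOrthogonal 𝒳)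
    (hK : tildeClass 𝒳 K) :
    ∃ M : ℤ → ModuleCat.{u} R, (∀ j, 𝒳 (M j)) ∧ Nonempty (disk M ≅ K) :=
  ⟨fun j => K.opcycles j, opcycles_of_tildeClass hK,
    ((Splicing.ofAcyclic hK.1).nonempty_iso_disk fun j => h𝒳 _ (opcycles_of_tildeClass hK j) _
      (opcycles_of_tildeClass hK (j + 1))).map Iso.symm⟩

noncomputable instance : HasExt.{u} (ChainComplex (ModuleCat.{u} R) ℤ) :=
  hasExt_of_enoughProjectives _

lemma leftExtOrthogonal_disk [𝒴.IsClosedUnderIsomorphisms] (h : ∀ j, leftExtOrthogonal 𝒴 (M j)) :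
    leftExtOrthogonal (tildeClass 𝒴) (disk M) := fun _ hH =>
  extVanishes_disk fun j => .of_shortExact_right ((Splicing.ofAcyclic hH.1).shortExact j)
    (h j _ (opcycles_of_tildeClass hH (j + 1))) (h j _ (opcycles_of_tildeClass hH j))

lemma coresolved_disk [𝒳.IsClosedUnderIsomorphisms] [𝒴.IsClosedUnderIsomorphisms]
    (h : ∀ j, coresolved 𝒳 𝒴 (M j)) : coresolved (tildeClass 𝒳) (tildeClass 𝒴) (disk M) := by
  refine le_coresolved (𝒢 := fun D => ∃ N : ℤ → ModuleCat.{u} R, (∀ j, coresolved 𝒳 𝒴 (N j)) ∧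
    disk N = D) ?_ _ ⟨M, h, rfl⟩
  rintro _ ⟨N, hN, rfl⟩
  choose hN_orth L hNL hL using fun j => coresolved_iff.1 (hN j)
  choose Q f g w hS hQ using hNL
  exact ⟨leftExtOrthogonal_disk hN_orth, disk L,
    .of_shortExact (shortExact_diskMap f g w hS) ((diskSplicing Q).tildeClass hQ), L, hL, rfl⟩

lemma tildeClass_le_leftExtOrthogonal [𝒳.IsClosedUnderIsomorphisms] [𝒴.IsClosedUnderIsomorphisms]
    (h𝒳 : 𝒳 ≤ leftExtOrthogonal 𝒳) (h𝒳𝒴 : 𝒳 ≤ leftExtOrthogonal 𝒴) :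
    tildeClass 𝒳 ≤ leftExtOrthogonal (tildeClass 𝒴) := by
  intro K hK
  obtain ⟨M, hM, ⟨e⟩⟩ := exists_iso_disk h𝒳 hK
  exact ObjectProperty.prop_of_iso _ e (leftExtOrthogonal_disk fun j => h𝒳𝒴 _ (hM j))

lemma tildeClass_le_coresolved [𝒳.IsClosedUnderIsomorphisms] [𝒴.IsClosedUnderIsomorphisms]
    [𝒵.IsClosedUnderIsomorphisms] (h𝒵 : 𝒵 ≤ leftExtOrthogonal 𝒵) (h : 𝒵 ≤ coresolved 𝒳 𝒴) :
    tildeClass 𝒵 ≤ coresolved (tildeClass 𝒳) (tildeClass 𝒴) := by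
  intro K hK
  obtain ⟨M, hM, ⟨e⟩⟩ := exists_iso_disk h𝒵 hK
  exact ObjectProperty.prop_of_iso _ e (coresolved_disk fun j => h _ (hM j))

instance : (projectiveModules R).IsClosedUnderIsomorphisms where
  of_iso e h := by
    have : Module.Projective R _ := h
    exact .of_equiv e.toLinearEquiv

lemma projectiveModules_le_leftExtOrthogonal :
    projectiveModules R ≤ leftExtOrthogonal 𝒴 := fun P hP Y _ =>
  have := (IsProjective.iff_projective (R := R) P).1 hP
  .of_projective P Y

lemma exists_isSyzygy_projectiveComplexes (Y : ChainComplex (ModuleCat.{u} R) ℤ) :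
    ∃ K, IsSyzygy (projectiveComplexes R) K Y :=
  ⟨_, .of_shortExact (shortExact_kernel_ι (diskDesc fun j => Projective.π (Y.X j)))
    ((diskSplicing fun j => Projective.over (Y.X j)).tildeClass (𝒳 := projectiveModules R)
      fun j => (IsProjective.iff_projective (R := R) _).2 (Projective.projective_over (Y.X j)))⟩

end TildeClasses

section TensorHom

open TensorProduct

variable {R : Type*} [CommRing R] {A B D : Type*} [AddCommGroup A] [AddCommGroup B]
  [AddCommGroup D] [Module R A] [Module R B] [Module R D] (N F : Type*) [AddCommGroup N]
  [AddCommGroup F] [Module R N] [Module R F]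

lemma rTensorHomToHomRTensor_lcomp (f : A →ₗ[R] B) (x : (B →ₗ[R] N) ⊗[R] F) :
    rTensorHomToHomRTensor (.id R) A N F ((LinearMap.lcomp R N f).rTensor F x) =
      rTensorHomToHomRTensor (.id R) B N F x ∘ₗ f := by
  induction x with
  | zero => simp
  | add x y hx hy => simp only [map_add, hx, hy, LinearMap.add_comp]
  | tmul φ y => ext a; simp

variable (A) in
lemma rTensorHomToHomRTensor_bijective_of_projective [Module.Finite R A] [Module.Projective R A] :
    Function.Bijective (rTensorHomToHomRTensor (.id R) A N F) := by
  rw [← rTensorHomEquivHomRTensor_toLinearMap]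
  exact (rTensorHomEquivHomRTensor R A N F).bijective

lemma rTensorHomToHomRTensor_injective [Module.Flat R F] [Module.Finite R A]
    [Module.Projective R A] {g : A →ₗ[R] B} (hg : Function.Surjective g) :
    Function.Injective (rTensorHomToHomRTensor (.id R) B N F) := by
  rw [injective_iff_map_eq_zero]
  intro x hx
  apply Module.Flat.rTensor_preserves_injective_linearMap (M := F) (LinearMap.lcomp R N g)
    (LinearMap.lcomp_injective_of_surjective g hg)
  apply (rTensorHomToHomRTensor_bijective_of_projective A N F).1
  rw [rTensorHomToHomRTensor_lcomp, hx, map_zero, map_zero, LinearMap.zero_comp]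

lemma rTensorHomToHomRTensor_surjective [Module.Flat R F] [Module.Finite R B]
    [Module.Projective R B] {f : A →ₗ[R] B} {g : B →ₗ[R] D} (hfg : Function.Exact f g)
    (hg : Function.Surjective g)
    (hA : Function.Injective (rTensorHomToHomRTensor (.id R) A N F)) :
    Function.Surjective (rTensorHomToHomRTensor (.id R) D N F) := by
  intro k
  obtain ⟨y, hy⟩ := (rTensorHomToHomRTensor_bijective_of_projective B N F).2 (k ∘ₗ g)
  have hy₀ : (LinearMap.lcomp R N f).rTensor F y = 0 := by
    apply hA
    rw [rTensorHomToHomRTensor_lcomp, hy, map_zero, LinearMap.comp_assoc,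
      hfg.linearMap_comp_eq_zero, LinearMap.comp_zero]
  obtain ⟨z, rfl⟩ := (Module.Flat.rTensor_exact F
    (LinearMap.exact_lcomp_of_exact_of_surjective N hfg hg) y).1 hy₀
  rw [rTensorHomToHomRTensor_lcomp] at hy
  exact ⟨z, (LinearMap.cancel_right hg).1 hy⟩

variable {N}

lemma surjective_lcomp_rTensor {f : A →ₗ[R] B} (h : Function.Surjective (LinearMap.lcomp R N f))
    (P : Type*) [AddCommGroup P] [Module R P] [Module.Projective R P] :
    Function.Surjective (LinearMap.lcomp R N (f.rTensor P)) := by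
  intro a
  obtain ⟨k, hk⟩ := Module.projective_lifting_property (LinearMap.lcomp R N f)
    (TensorProduct.curry a).flip h
  refine ⟨TensorProduct.lift k.flip, TensorProduct.ext' fun x p => ?_⟩
  simpa using LinearMap.congr_fun (LinearMap.congr_fun hk p) x

lemma surjective_lcomp_tensor {f : A →ₗ[R] B} (h : Function.Surjective (LinearMap.lcomp R N f))
    (hA : Function.Surjective (rTensorHomToHomRTensor (.id R) A N F)) :
    Function.Surjective (LinearMap.lcomp R (N ⊗[R] F) f) := by
  intro a
  obtain ⟨x, rfl⟩ := hA a
  obtain ⟨y, rfl⟩ := LinearMap.rTensor_surjective F h x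
  exact ⟨_, (rTensorHomToHomRTensor_lcomp N F f y).symm⟩

variable (N)

lemma mk_flip_bijective (h : Function.Bijective (algebraMap R (Module.End R N)))
    (hN : Function.Bijective (rTensorHomToHomRTensor (.id R) N N F)) :
    Function.Bijective (TensorProduct.mk R N F).flip := by
  let e : R ≃ₗ[R] (N →ₗ[R] N) :=
    LinearEquiv.ofBijective (Algebra.linearMap R (Module.End R N)) h
  have he : (TensorProduct.mk R N F).flip = rTensorHomToHomRTensor (.id R) N N F ∘ₗ
      ((TensorProduct.lid R F).symm.trans (e.rTensor F)).toLinearMap := by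
    ext y c
    have h₁ : e 1 = LinearMap.id := map_one (algebraMap R (Module.End R N))
    simp [h₁]
  rw [he, LinearMap.coe_comp]
  exact hN.comp (LinearEquiv.bijective _)

variable (R) in
/-- The biduality map `M ⊗ F → Hom(Hom(M, N), N ⊗ F)`, sending `m ⊗ y` to `φ ↦ φ m ⊗ y`. -/
def bidualMap (M : Type*) [AddCommGroup M] [Module R M] :
    M ⊗[R] F →ₗ[R] (M →ₗ[R] N) →ₗ[R] N ⊗[R] F :=
  (LinearMap.rTensorHom F).flip

lemma bidualMap_apply (M : Type*) [AddCommGroup M] [Module R M] (x : M ⊗[R] F)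
    (φ : M →ₗ[R] N) : bidualMap R N F M x φ = φ.rTensor F x := rfl

lemma bidualMap_rTensor (f : A →ₗ[R] B) (x : A ⊗[R] F) :
    bidualMap R N F B (f.rTensor F x) = bidualMap R N F A x ∘ₗ LinearMap.lcomp R N f := by
  ext φ
  exact (LinearMap.rTensor_comp_apply F φ f x).symm

lemma bidualMap_self_bijective (h : Function.Bijective (algebraMap R (Module.End R N))) :
    Function.Bijective (bidualMap R N F N) := by
  constructor
  · rw [injective_iff_map_eq_zero]
    intro x hx
    simpa only [bidualMap_apply, LinearMap.rTensor_id_apply, LinearMap.zero_apply] using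
      LinearMap.congr_fun hx LinearMap.id
  · intro ψ
    refine ⟨ψ LinearMap.id, LinearMap.ext fun φ => ?_⟩
    obtain ⟨r, rfl⟩ := h.2 φ
    have : algebraMap R (Module.End R N) r = r • (LinearMap.id : N →ₗ[R] N) :=
      Algebra.algebraMap_eq_smul_one r
    rw [this, map_smul, map_smul, bidualMap_apply, LinearMap.rTensor_id_apply]

lemma bidualMap_bijective_of_projective (hF : Function.Bijective (TensorProduct.mk R N F).flip)
    (M : Type*) [AddCommGroup M] [Module R M] [Module.Finite R M] [Module.Projective R M] :
    Function.Bijective (bidualMap R N F M) := by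
  let e : M ⊗[R] F ≃ₗ[R] (M →ₗ[R] N) →ₗ[R] N ⊗[R] F :=
    (Module.evalEquiv R M).rTensor F ≪≫ₗ dualTensorHomEquiv R (Module.Dual R M) F ≪≫ₗ
      (LinearEquiv.refl R _).arrowCongr (LinearEquiv.ofBijective _ hF) ≪≫ₗ
      TensorProduct.lift.equiv (.id R) _ N (N ⊗[R] F) ≪≫ₗ
      (dualTensorHomEquiv R M N).arrowCongr (LinearEquiv.refl R _)
  have he : bidualMap R N F M = e.toLinearMap := by
    refine TensorProduct.ext' fun m y =>
      (LinearMap.cancel_right (dualTensorHomEquiv R M N).surjective).1 ?_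
    ext φ n
    simp [e, bidualMap_apply, TensorProduct.smul_tmul]
  rw [he]
  exact LinearEquiv.bijective _

variable {N F}

lemma bidualMap_injective_of_injective [Module.Flat R F] {i : A →ₗ[R] B}
    (hi : Function.Injective i) (hB : Function.Injective (bidualMap R N F B)) :
    Function.Injective (bidualMap R N F A) := by
  rw [injective_iff_map_eq_zero]
  intro x hx
  apply Module.Flat.rTensor_preserves_injective_linearMap (M := F) i hi
  apply hB
  rw [map_zero, map_zero, bidualMap_rTensor, hx, LinearMap.zero_comp]

lemma bidualMap_surjective_of_exact {i : A →ₗ[R] B} {p : B →ₗ[R] D}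
    (hip : Function.Exact i p) (hp : Function.Surjective p)
    (hi : Function.Surjective (LinearMap.lcomp R N i))
    (hB : Function.Surjective (bidualMap R N F B)) (hD : Function.Injective (bidualMap R N F D)) :
    Function.Surjective (bidualMap R N F A) := by
  intro ψ
  obtain ⟨y, hy⟩ := hB (ψ ∘ₗ LinearMap.lcomp R N i)
  have hy₀ : p.rTensor F y = 0 := by
    apply hD
    rw [map_zero, bidualMap_rTensor, hy]
    ext φ
    change ψ (φ ∘ₗ p ∘ₗ i) = 0
    rw [hip.linearMap_comp_eq_zero, LinearMap.comp_zero, map_zero]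
  obtain ⟨x, rfl⟩ := (rTensor_exact F hip hp y).1 hy₀
  rw [bidualMap_rTensor] at hy
  exact ⟨x, (LinearMap.cancel_right hi).1 hy⟩

lemma surjective_lcomp_lcomp {p : B →ₗ[R] D} (hp : Function.Surjective p)
    (hD : Function.Surjective (bidualMap R N F D)) :
    Function.Surjective (LinearMap.lcomp R (N ⊗[R] F) (LinearMap.lcomp R N p)) := by
  intro ψ
  obtain ⟨x, rfl⟩ := hD ψ
  obtain ⟨y, rfl⟩ := LinearMap.rTensor_surjective F hp x
  exact ⟨bidualMap R N F B y, (bidualMap_rTensor N F p y).symm⟩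

end TensorHom

section Resolved

universe v w

variable {𝒜 : Type w} [Category.{v} 𝒜] [Abelian 𝒜] (𝒬 : ObjectProperty 𝒜)

/-- The operator on classes of objects whose greatest fixed point is `resolved 𝒬`. -/
def resolutionStep : ObjectProperty 𝒜 →o ObjectProperty 𝒜 where
  toFun 𝒢 X := ∃ K, IsSyzygy 𝒬 K X ∧ 𝒢 K
  monotone' _ _ h _ := fun ⟨K, hKX, hK⟩ => ⟨K, hKX, h K hK⟩

/-- The class of objects `X` admitting a resolution `⋯ ⟶ Q₁ ⟶ Q₀ ⟶ X ⟶ 0` by objects of `𝒬`,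
encoded coinductively. -/
def resolved : ObjectProperty 𝒜 :=
  (resolutionStep 𝒬).gfp

variable {𝒬}

lemma resolved_iff {X : 𝒜} : resolved 𝒬 X ↔ ∃ K, IsSyzygy 𝒬 K X ∧ resolved 𝒬 K :=
  iff_of_eq (congrFun (resolutionStep 𝒬).map_gfp X).symm

lemma le_resolved {𝒢 : ObjectProperty 𝒜} (h : ∀ X, 𝒢 X → ∃ K, IsSyzygy 𝒬 K X ∧ 𝒢 K) :
    𝒢 ≤ resolved 𝒬 :=
  (resolutionStep 𝒬).le_gfp h

lemma resolved_of_projectiveResolution {X : 𝒜} (P : ProjectiveResolution X)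
    (hP : ∀ n, 𝒬 (P.complex.X n)) : resolved 𝒬 X := by
  let e : P.complex.opcycles 0 ≅ X :=
    (P.complex.opcyclesIsCokernel 1 0 (by simp)).coconePointUniqueUpToIso P.isColimitCokernelCofork
  refine le_resolved (𝒢 := fun Y => ∃ n, Nonempty (P.complex.opcycles n ≅ Y)) ?_ _ ⟨0, ⟨e⟩⟩
  rintro Y ⟨n, ⟨e⟩⟩
  have hS := shortExact_opcycles P.complex (i := n + 1) (j := n) rfl (P.complex_exactAt_succ n)
  exact ⟨_, (IsSyzygy.of_shortExact hS (hP n)).of_iso (Iso.refl _) e, n + 1, ⟨Iso.refl _⟩⟩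

end Resolved

section ModuleClasses

variable {R : Type u} [CommRing R] {C : ModuleCat.{u} R}

instance : (cProjectiveModules C).IsClosedUnderIsomorphisms where
  of_iso e := fun ⟨P, hP, ⟨f⟩⟩ => ⟨P, hP, ⟨e.toLinearEquiv.symm.trans f⟩⟩

instance : (cFlatModules C).IsClosedUnderIsomorphisms where
  of_iso e := fun ⟨F, hF, ⟨f⟩⟩ => ⟨F, hF, ⟨e.toLinearEquiv.symm.trans f⟩⟩

instance : (cProjectiveModules C).IsClosedUnderBinaryProducts :=
  isClosedUnderBinaryProducts_of_biprod fun M N ⟨P, _, ⟨e⟩⟩ ⟨Q, _, ⟨f⟩⟩ =>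
    ⟨.of R (P × Q), inferInstanceAs (Module.Projective R (P × Q)),
      ⟨(ModuleCat.biprodIsoProd M N).toLinearEquiv.trans
        ((e.prodCongr f).trans (TensorProduct.prodRight R R C P Q).symm)⟩⟩

lemma cProjectiveModules_le_cFlatModules : cProjectiveModules C ≤ cFlatModules C :=
  fun _ ⟨P, _, e⟩ => ⟨P, inferInstance, e⟩

variable (R) in
/-- The class of finitely generated projective modules. The objects of
`resolved (finiteProjectiveModules R)` are the modules of type `FP_∞`. -/
def finiteProjectiveModules : ObjectProperty (ModuleCat.{u} R) :=
  fun M => Module.Finite R M ∧ Module.Projective R M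

lemma shortExact_ofHom {A B D : Type u} [AddCommGroup A] [AddCommGroup B] [AddCommGroup D]
    [Module R A] [Module R B] [Module R D] {f : A →ₗ[R] B} {g : B →ₗ[R] D}
    (hf : Function.Injective f) (hfg : Function.Exact f g) (hg : Function.Surjective g) :
    (ShortComplex.mk (ModuleCat.ofHom f) (ModuleCat.ofHom g)
      (ModuleCat.hom_ext hfg.linearMap_comp_eq_zero)).ShortExact where
  exact := (ShortComplex.ShortExact.moduleCat_exact_iff_function_exact _).2 hfg
  mono_f := (ModuleCat.mono_iff_injective _).2 hf
  epi_g := (ModuleCat.epi_iff_surjective _).2 hg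

lemma surjective_precomp_ofHom {A B N : Type u} [AddCommGroup A] [AddCommGroup B] [AddCommGroup N]
    [Module R A] [Module R B] [Module R N] {f : A →ₗ[R] B}
    (h : Function.Surjective (LinearMap.lcomp R N f)) :
    Function.Surjective
      (fun b : ModuleCat.of R B ⟶ ModuleCat.of R N => ModuleCat.ofHom f ≫ b) := fun a =>
  (h a.hom).imp' ModuleCat.ofHom fun _ hb => ModuleCat.hom_ext hb

lemma ExtVanishes.surjective_lcomp {S : ShortComplex (ModuleCat.{u} R)} (hS : S.ShortExact)
    {N : ModuleCat.{u} R} (h : ExtVanishes S.X₃ N) :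
    Function.Surjective (LinearMap.lcomp R N S.f.hom) := fun a =>
  (h.surjective_precomp hS (ModuleCat.ofHom a)).imp' ModuleCat.Hom.hom
    fun _ hb => congrArg ModuleCat.Hom.hom hb

end ModuleClasses

section TotallyReflexive

open TensorProduct

variable {R : Type u} [CommRing R] {C M N : ModuleCat.{u} R} {S : ShortComplex (ModuleCat.{u} R)}

lemma function_exact_of_shortExact (hS : S.ShortExact) : Function.Exact S.f.hom S.g.hom :=
  (ShortComplex.ShortExact.moduleCat_exact_iff_function_exact S).1 hS.exact

lemma shortExact_rTensor (hS : S.ShortExact) (P : Type u) [AddCommGroup P] [Module R P]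
    [Module.Flat R P] :
    ∃ w, (ShortComplex.mk (ModuleCat.ofHom (S.f.hom.rTensor P))
      (ModuleCat.ofHom (S.g.hom.rTensor P)) w).ShortExact :=
  ⟨_, shortExact_ofHom
    (Module.Flat.rTensor_preserves_injective_linearMap _ hS.moduleCat_injective_f)
    (Module.Flat.rTensor_exact P (function_exact_of_shortExact hS))
    (LinearMap.rTensor_surjective P hS.moduleCat_surjective_g)⟩

lemma shortExact_lcomp_rTensor (hS : S.ShortExact)
    (hf : Function.Surjective (LinearMap.lcomp R N S.f.hom)) (P : Type u) [AddCommGroup P]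
    [Module R P] [Module.Flat R P] :
    ∃ w, (ShortComplex.mk (ModuleCat.ofHom ((LinearMap.lcomp R N S.g.hom).rTensor P))
      (ModuleCat.ofHom ((LinearMap.lcomp R N S.f.hom).rTensor P)) w).ShortExact :=
  ⟨_, shortExact_ofHom
    (Module.Flat.rTensor_preserves_injective_linearMap _
      (LinearMap.lcomp_injective_of_surjective _ hS.moduleCat_surjective_g))
    (Module.Flat.rTensor_exact P (LinearMap.exact_lcomp_of_exact_of_surjective N
      (function_exact_of_shortExact hS) hS.moduleCat_surjective_g))
    (LinearMap.rTensor_surjective P hf)⟩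

lemma rTensorHomToHomRTensor_bijective_of_resolved
    (hM : resolved (finiteProjectiveModules R) M) (N F : Type u) [AddCommGroup N] [AddCommGroup F]
    [Module R N] [Module R F] [Module.Flat R F] :
    Function.Bijective (rTensorHomToHomRTensor (.id R) M N F) := by
  obtain ⟨K, ⟨L, i, p, w, hS, _, _⟩, hK⟩ := resolved_iff.1 hM
  obtain ⟨_, ⟨L', i', p', w', hS', _, _⟩, _⟩ := resolved_iff.1 hK
  exact ⟨rTensorHomToHomRTensor_injective N F hS.moduleCat_surjective_g,
    rTensorHomToHomRTensor_surjective N F (function_exact_of_shortExact hS)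
      hS.moduleCat_surjective_g
      (rTensorHomToHomRTensor_injective N F hS'.moduleCat_surjective_g)⟩

lemma leftExtOrthogonal_cFlatModules_tensor (hM : resolved (finiteProjectiveModules R) M)
    (hMC : ExtVanishes M C) (P : Type u) [AddCommGroup P] [Module R P] [Module.Projective R P] :
    leftExtOrthogonal (cFlatModules C) (.of R (M ⊗[R] P)) := by
  rintro H ⟨F, _, ⟨e⟩⟩
  refine .of_iso_right e.toModuleIso.symm (.of_forall_exists_shortExact
    (ι := {M : ModuleCat.{u} R // resolved (finiteProjectiveModules R) M ∧ ExtVanishes M C})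
    (X := fun M => ModuleCat.of R (M.1 ⊗[R] P)) ?_ ⟨M, hM, hMC⟩)
  rintro ⟨M, hM, hMC⟩
  obtain ⟨K, ⟨L, i, p, w, hS, _, hL⟩, hK⟩ := resolved_iff.1 hM
  have : Projective L := (IsProjective.iff_projective (R := R) L).1 hL
  have : Projective (ModuleCat.of R (L ⊗[R] P)) :=
    (IsProjective.iff_projective (R := R) _).1 inferInstance
  obtain ⟨w', hS'⟩ := shortExact_rTensor hS P
  have hext : Function.Surjective (LinearMap.lcomp R (C ⊗[R] F) i.hom) :=
    surjective_lcomp_tensor F (hMC.surjective_lcomp hS)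
      (rTensorHomToHomRTensor_bijective_of_resolved hK C F).2
  exact ⟨⟨K, hK, .of_shortExact₁ hS (.of_projective L C) hMC⟩, _, _, _, w', hS',
    .of_projective _ _, surjective_precomp_ofHom (surjective_lcomp_rTensor hext P)⟩

lemma cProjectiveModules_dual_tensor (hM : finiteProjectiveModules R M) (P : Type u)
    [AddCommGroup P] [Module R P] [Module.Projective R P] :
    cProjectiveModules C (.of R ((M →ₗ[R] C) ⊗[R] P)) := by
  have ⟨_, _⟩ := hM
  have : Module.Projective R (Module.Dual R M ⊗[R] P) := inferInstance
  exact ⟨.of R (Module.Dual R M ⊗[R] P), this,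
    ⟨((dualTensorHomEquiv R M C).symm ≪≫ₗ TensorProduct.comm R _ _).rTensor P ≪≫ₗ
      TensorProduct.assoc R C _ P⟩⟩

/-- `M` is totally `C`-reflexive: it is of type `FP_∞`, it is isomorphic to its bidual with
respect to `C`, and both `Ext^n(M, C)` and `Ext^n(Hom(M, C), C)` vanish for `n ≥ 1`. The last two
fields are stated with coefficients in flat modules `F` and projective modules `P`. -/
structure IsTotallyReflexive (C M : ModuleCat.{u} R) : Prop where
  resolved : resolved (finiteProjectiveModules R) M
  extVanishes : ExtVanishes M C
  bidualMap_bijective (F : Type u) [AddCommGroup F] [Module R F] [Module.Flat R F] :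
    Function.Bijective (bidualMap R C F M)
  leftExtOrthogonal_dual_tensor (P : Type u) [AddCommGroup P] [Module R P]
    [Module.Projective R P] :
    leftExtOrthogonal (cFlatModules C) (.of R ((M →ₗ[R] C) ⊗[R] P))

namespace IsSemidualizing

variable (hC : IsSemidualizing C)

include hC

lemma resolved : resolved (finiteProjectiveModules R) C :=
  hC.exists_resolution.elim fun P hP => resolved_of_projectiveResolution P fun n =>
    ⟨hP n, (IsProjective.iff_projective _).2 (P.projective n)⟩

lemma extVanishes_self : ExtVanishes C C :=
  fun n _ => (hC.ext_eq_zero (n + 1) n.succ_pos).elim _ _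

lemma cProjectiveModules_le_leftExtOrthogonal :
    cProjectiveModules C ≤ leftExtOrthogonal (cFlatModules C) := fun _ ⟨P, _, ⟨e⟩⟩ =>
  (leftExtOrthogonal _).prop_of_iso e.toModuleIso.symm
    (leftExtOrthogonal_cFlatModules_tensor hC.resolved hC.extVanishes_self P)

/-- The homothety isomorphism. -/
noncomputable def homothetyEquiv : R ≃ₗ[R] (C →ₗ[R] C) :=
  .ofBijective (Algebra.linearMap R (Module.End R C)) hC.homothety_bijective

lemma isTotallyReflexive_self : IsTotallyReflexive C C where
  resolved := hC.resolved
  extVanishes := hC.extVanishes_self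
  bidualMap_bijective F _ _ _ := bidualMap_self_bijective C F hC.homothety_bijective
  leftExtOrthogonal_dual_tensor P _ _ _ := by
    have : Module.Projective R (C →ₗ[R] C) := .of_equiv hC.homothetyEquiv
    have hP : Module.Projective R ((C →ₗ[R] C) ⊗[R] P) := inferInstance
    exact projectiveModules_le_leftExtOrthogonal _ hP

lemma isTotallyReflexive_X₁ (hS : S.ShortExact)
    (h₁ : DingC.resolved (finiteProjectiveModules R) S.X₁)
    (h₂ : finiteProjectiveModules R S.X₂) (h₃ : IsTotallyReflexive C S.X₃) :
    IsTotallyReflexive C S.X₁ where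
  resolved := h₁
  extVanishes := by
    have := (IsProjective.iff_projective (R := R) S.X₂).1 h₂.2
    exact .of_shortExact₁ hS (.of_projective _ C) h₃.extVanishes
  bidualMap_bijective F _ _ _ := by
    have ⟨_, _⟩ := h₂
    have hX₂ : Function.Bijective (bidualMap R C F S.X₂) :=
      bidualMap_bijective_of_projective _ _ (mk_flip_bijective _ _ hC.homothety_bijective
        (rTensorHomToHomRTensor_bijective_of_resolved hC.resolved C F)) _
    exact ⟨bidualMap_injective_of_injective hS.moduleCat_injective_f hX₂.1,
      bidualMap_surjective_of_exact (function_exact_of_shortExact hS) hS.moduleCat_surjective_g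
        (h₃.extVanishes.surjective_lcomp hS) hX₂.2 (h₃.bidualMap_bijective F).1⟩
  leftExtOrthogonal_dual_tensor P _ _ _ := by
    rintro H ⟨F, _, ⟨e⟩⟩
    obtain ⟨w, hS'⟩ := shortExact_lcomp_rTensor hS (h₃.extVanishes.surjective_lcomp hS) P
    have hF : cFlatModules C (.of R (C ⊗[R] F)) := ⟨F, inferInstance, ⟨.refl R _⟩⟩
    exact .of_iso_right e.toModuleIso.symm (.of_shortExact₃ hS'
      (h₃.leftExtOrthogonal_dual_tensor P _ hF)
      (hC.cProjectiveModules_le_leftExtOrthogonal _ (cProjectiveModules_dual_tensor h₂ P) _ hF)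
      (surjective_precomp_ofHom (surjective_lcomp_rTensor (surjective_lcomp_lcomp
        hS.moduleCat_surjective_g (h₃.bidualMap_bijective F).2) P)))

/-- Dualizing a resolution of `C` by finitely generated projectives and tensoring with a projective
`P` yields a coresolution of `Hom(C, C) ⊗ P ≅ P`. -/
lemma projectiveModules_le_coresolved :
    projectiveModules R ≤ coresolved (cProjectiveModules C) (cFlatModules C) := by
  intro P (_ : Module.Projective R P)
  let e : P ≃ₗ[R] (C →ₗ[R] C) ⊗[R] P :=
    (TensorProduct.lid R P).symm ≪≫ₗ hC.homothetyEquiv.rTensor P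
  refine (coresolved _ _).prop_of_iso e.toModuleIso.symm (le_coresolved
    (𝒢 := fun X => ∃ M, IsTotallyReflexive C M ∧ .of R ((M →ₗ[R] C) ⊗[R] P) = X) ?_ _
    ⟨C, hC.isTotallyReflexive_self, rfl⟩)
  rintro _ ⟨M, hM, rfl⟩
  obtain ⟨K, ⟨L, i, p, w, hS, hL⟩, hK⟩ := resolved_iff.1 hM.resolved
  obtain ⟨w', hS'⟩ := shortExact_lcomp_rTensor hS (hM.extVanishes.surjective_lcomp hS) P
  exact ⟨hM.leftExtOrthogonal_dual_tensor P, _,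
    .of_shortExact hS' (cProjectiveModules_dual_tensor hL P), K,
    hC.isTotallyReflexive_X₁ hS hK hL hM, rfl⟩

end IsSemidualizing

end TotallyReflexive

section DCProjective

variable {R : Type u} [CommRing R] {C : ModuleCat.{u} R} {X : ChainComplex (ModuleCat.{u} R) ℤ}
  {E : ChainComplex (ChainComplex (ModuleCat.{u} R) ℤ) ℤ}

lemma cProjectiveComplexes_le_cFlatComplexes : cProjectiveComplexes C ≤ cFlatComplexes C :=
  tildeClass_mono cProjectiveModules_le_cFlatModules

instance : (cProjectiveComplexes C).IsClosedUnderBinaryProducts :=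
  inferInstanceAs (tildeClass (cProjectiveModules C)).IsClosedUnderBinaryProducts

lemma IsSemidualizing.cProjectiveComplexes_le_leftExtOrthogonal (hC : IsSemidualizing C) :
    cProjectiveComplexes C ≤ leftExtOrthogonal (cFlatComplexes C) :=
  tildeClass_le_leftExtOrthogonal
    (fun M hM N hN => hC.cProjectiveModules_le_leftExtOrthogonal M hM N
      (cProjectiveModules_le_cFlatModules N hN))
    hC.cProjectiveModules_le_leftExtOrthogonal

lemma IsSemidualizing.projectiveComplexes_le_coresolved (hC : IsSemidualizing C) :
    projectiveComplexes R ≤ coresolved (cProjectiveComplexes C) (cFlatComplexes C) :=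
  tildeClass_le_coresolved projectiveModules_le_leftExtOrthogonal
    hC.projectiveModules_le_coresolved

lemma isDCProjective_of_coresolved
    (hX : coresolved (cProjectiveComplexes C) (cFlatComplexes C) X) : IsDCProjective C X := by
  obtain ⟨K, Z, s, hom_exact, hP, hQ, rfl⟩ :=
    exists_splicing_of_coresolved exists_isSyzygy_projectiveComplexes
      (tildeClass_le_leftExtOrthogonal projectiveModules_le_leftExtOrthogonal
        projectiveModules_le_leftExtOrthogonal) hX
  obtain ⟨e⟩ := s.nonempty_imageIso 0 (-1) rfl
  exact ⟨K, ⟨s.acyclic, hom_exact, hP, hQ⟩, ⟨e.symm⟩⟩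

lemma IsPQSequence.coresolved_opcycles (hE : IsPQSequence C E) (hC : IsSemidualizing C) (j : ℤ) :
    coresolved (cProjectiveComplexes C) (cFlatComplexes C) (E.opcycles j) :=
  (Splicing.ofAcyclic hE.exact).coresolved hE.homExact cProjectiveComplexes_le_cFlatComplexes
    hC.cProjectiveComplexes_le_leftExtOrthogonal
    (fun i hi => hC.projectiveComplexes_le_coresolved _ (hE.projective i hi)) hE.cProjective j

end DCProjective

end DingC

theorem corollary2p13 {R : Type u} [CommRing R] (C : ModuleCat.{u} R)
    (hC : DingC.IsSemidualizing C)
    (E : ChainComplex (ChainComplex (ModuleCat.{u} R) ℤ) ℤ)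
    (hExact : E.Acyclic)
    (hHom : DingC.IsHomExact (DingC.cFlatComplexes C) E)
    (hP : ∀ i : ℤ, 0 ≤ i → DingC.projectiveComplexes R (E.X i))
    (hQ : ∀ i : ℤ, i < 0 → DingC.cProjectiveComplexes C (E.X i)) :
    ∀ i : ℤ, DingC.IsDCProjective C (cokernel (E.d i (i - 1))) := by
  intro i
  have hE : DingC.IsPQSequence C E := ⟨hExact, hHom, hP, hQ⟩
  let e : cokernel (E.d i (i - 1)) ≅ E.opcycles (i - 1) :=
    (cokernelIsCokernel _).coconePointUniqueUpToIso (E.opcyclesIsCokernel i (i - 1) (by simp))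
  exact DingC.isDCProjective_of_coresolved
    ((DingC.coresolved _ _).prop_of_iso e.symm (hE.coresolved_opcycles hC (i - 1)))
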